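/- **Setting.** Let $d\ge 1$, $n\ge 2$, $\epsilon\ge 0$, $\theta\in\mathbb R^d$, and $\Delta:\mathbb R^d\to\mathbb R$ with $\sup_x|\Delta(x)|\le\epsilon$. For $t=1,\dots,n$ let $\Phi_t\in\mathbb R^{k_t\times d}$, $k_t\ge1$, be a (deterministic) feature matrix, and assume that $\|a\|_2\le 1$ and $|\langle a,\theta\rangle|\le 1$ for all $a\in\bigcup_{t=1}^n\operatorname{rows}(\Phi_t)$. In round $t$ the learner observes $\Phi_t$, chooses $X_t\in\operatorname{rows}(\Phi_t)$ on the basis of the past (and possibly independent randomisation), and receives $Y_t=\langle X_t,\theta\rangle+\Delta(X_t)+\eta_t$. Here $\eta_1,\dots,\eta_n$ are $1$-subgaussian random variables ($\mathbb E e^{\lambda\eta_t}\le e^{\lambda^2/2}$ for all $\lambda\in\mathbb R$), each $\eta_t$ being independent of everything that precedes it, including $X_1,\dots,X_t$; in particular they are independent of one another. Put $\mu(a)=\langle a,\theta\rangle+\Delta(a)$ and define the expected regret $$R_n=\mathbb E\Big[\sum_{t=1}^n\Big(\max_{a\in\operatorname{rows}(\Phi_t)}\mu(a)-\mu(X_t)\Big)\Big].$$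 **Algorithm.** Let $G_t=I+\sum_{s=1}^tX_sX_s^\top$, $\hat\theta_t=G_t^{-1}\sum_{s=1}^tX_sY_s$, $\|a\|_{G_t^{-1}}=\sqrt{a^\top G_t^{-1}a}$ and $\beta=1+\sqrt{2\log n+d\log(1+n/d)}$. The modified LinUCB algorithm, which knows $\epsilon$ and $n$, chooses for $t=0,\dots,n-1$ $$X_{t+1}\in\operatorname*{argmax}_{a\in\operatorname{rows}(\Phi_{t+1})}\ \langle a,\hat\theta_t\rangle+\beta\|a\|_{G_t^{-1}}+\epsilon\sum_{s=1}^t|a^\top G_t^{-1}X_s|,$$ ties being broken in an arbitrary way that does not look into the future. **Theorem.** The regret of this algorithm satisfies $$R_n\le C\left(d\sqrt n\,\log n+n\epsilon\sqrt{d\log n}\right),$$ where $C$ depends on $d$ and $\|\theta\|_2$ only, and is one universal constant for all $d$ and all $\theta$ with $\|\theta\|_2\le 1$. -/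

import Mathlib

open MeasureTheory ProbabilityTheory
open scoped Matrix

namespace MisspecifiedBandit

/-- The Euclidean norm of a vector of `ℝ^d`. -/
noncomputable def euclNorm {d : ℕ} (a : Fin d → ℝ) : ℝ := ‖WithLp.toLp 2 a‖

/-- The set of rows of a feature matrix, i.e. the set of available actions. -/
def rows {k d : ℕ} (Φ : Matrix (Fin k) (Fin d) ℝ) : Set (Fin d → ℝ) := Set.range Φ.row

/-- Mean reward `⟨a, θ⟩ + Δ(a)` of the action with feature vector `a`. -/
noncomputable def meanReward {d : ℕ} (θ : Fin d → ℝ) (Δ : (Fin d → ℝ) → ℝ) (a : Fin d → ℝ) : ℝ :=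
  a ⬝ᵥ θ + Δ a

/-- The regularised Gram matrix `G_t = I + ∑_{s=1}^t x_s x_sᵀ`. -/
noncomputable def gram {d : ℕ} (x : ℕ → Fin d → ℝ) (t : ℕ) : Matrix (Fin d) (Fin d) ℝ :=
  1 + ∑ s ∈ Finset.Icc 1 t, Matrix.vecMulVec (x s) (x s)

/-- The regularised least-squares estimator `G_t⁻¹ ∑_{s=1}^t x_s y_s`. -/
noncomputable def estimator {d : ℕ} (x : ℕ → Fin d → ℝ) (y : ℕ → ℝ) (t : ℕ) : Fin d → ℝ :=
  (gram x t)⁻¹ *ᵥ ∑ s ∈ Finset.Icc 1 t, y s • x s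

/-- `‖a‖_A = √(aᵀ A a)`. -/
noncomputable def weightedNorm {d : ℕ} (A : Matrix (Fin d) (Fin d) ℝ) (a : Fin d → ℝ) : ℝ :=
  √(a ⬝ᵥ A *ᵥ a)

/-- The confidence width `β = 1 + √(2 log n + d log (1 + n / d))` for horizon `n`. -/
noncomputable def confWidth (n d : ℕ) : ℝ :=
  1 + √(2 * Real.log n + d * Real.log (1 + (n : ℝ) / d))

/-- The index that the modified LinUCB algorithm assigns to `a` after `t` rounds with actions
`x_1, …, x_t` and rewards `y_1, …, y_t`:
`⟨a, θ̂_t⟩ + ‖a‖_{G_t⁻¹} β + ε ∑_{s=1}^t |aᵀ G_t⁻¹ x_s|`. -/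
noncomputable def ucbIndex {d : ℕ} (n : ℕ) (ε : ℝ) (x : ℕ → Fin d → ℝ) (y : ℕ → ℝ) (t : ℕ)
    (a : Fin d → ℝ) : ℝ :=
  a ⬝ᵥ estimator x y t + weightedNorm (gram x t)⁻¹ a * confWidth n d
    + ε * ∑ s ∈ Finset.Icc 1 t, |a ⬝ᵥ (gram x t)⁻¹ *ᵥ x s|

/-- Expected regret
`R_n = 𝔼 [∑_{t=1}^n (max_{a ∈ rows Φ_t} (⟨a, θ⟩ + Δ(a)) - (⟨X_t, θ⟩ + Δ(X_t)))]`. -/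
noncomputable def regret {d : ℕ} {Ω : Type*} [MeasurableSpace Ω] (P : Measure Ω) (n : ℕ)
    {k : ℕ → ℕ} (Φ : (t : ℕ) → Matrix (Fin (k t)) (Fin d) ℝ) (θ : Fin d → ℝ)
    (Δ : (Fin d → ℝ) → ℝ) (X : ℕ → Ω → Fin d → ℝ) : ℝ :=
  ∫ ω, ∑ t ∈ Finset.Icc 1 n,
    (sSup (meanReward θ Δ '' rows (Φ t)) - meanReward θ Δ (X t ω)) ∂P

end MisspecifiedBandit

/-! The error of `θ̂_t` in direction `a` has three parts: noise, at most `‖a‖_{G⁻¹} ‖S_t‖_{G⁻¹}`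
with `S_t = ∑ η_s X_s`; regularisation bias, at most `‖a‖_{G⁻¹} ‖θ‖`; and misspecification, at most
the extra bonus `ε ∑ |aᵀ G⁻¹ X_s|` (`abs_estimator_error_le`). If `‖S_t‖_{G⁻¹} + ‖θ‖ ≤ β`, optimism
bounds the regret of the round by `2ε` plus twice the bonus of the chosen action
(`meanReward_sub_le`). Cauchy-Schwarz bounds the extra bonus by `ε √t ‖a‖_{G⁻¹}`, and the elliptical
potential bounds the sum of the widths (`sum_weightedNorm_le`); this yields both terms.

The confidence bound comes from the method of mixtures: `exp (‖S_t‖² / 2) / √(det G_t)` has mean at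
most one (`lintegral_selfNormalized_le_one`). A bound at each fixed time suffices, since only the
expected number of failing rounds enters. The `1` in `β` pays for `‖θ‖ ≤ 1`; an excess `ρ` raises
the failure probability to `exp (ρ (β - 1)) / n`, and as `β - 1` is of order `√(d log n)`, this
costs a factor depending on `d` and `ρ` and a `√n` (`regret_bound_numeric`). -/

namespace MisspecifiedBandit

/-! ### Quadratic forms, determinants and rank-one updates. -/

section RankOne

variable {d : ℕ} {A : Matrix (Fin d) (Fin d) ℝ}

lemma mulVec_inv_mulVec (hA : A.PosDef) (v : Fin d → ℝ) : A *ᵥ (A⁻¹ *ᵥ v) = v := by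
  rw [Matrix.mulVec_mulVec, Matrix.mul_nonsing_inv _ ((Matrix.isUnit_iff_isUnit_det _).1 hA.isUnit),
    Matrix.one_mulVec]

lemma inv_mulVec_eq (hA : A.PosDef) {v b : Fin d → ℝ} (h : A *ᵥ b = v) : A⁻¹ *ᵥ v = b := by
  rw [← h, Matrix.mulVec_mulVec, Matrix.nonsing_inv_mul _
    ((Matrix.isUnit_iff_isUnit_det _).1 hA.isUnit), Matrix.one_mulVec]

lemma dotProduct_mulVec_symm (hA : A.IsHermitian) (u v : Fin d → ℝ) :
    u ⬝ᵥ A *ᵥ v = v ⬝ᵥ A *ᵥ u := by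
  have h : Aᵀ = A := by simpa using hA.eq
  rw [Matrix.dotProduct_mulVec, ← Matrix.mulVec_transpose, h, dotProduct_comm]

lemma dotProduct_mulVec_self_nonneg (hA : A.PosSemidef) (u : Fin d → ℝ) : 0 ≤ u ⬝ᵥ A *ᵥ u := by
  simpa using hA.dotProduct_mulVec_nonneg u

/-- Cauchy-Schwarz inequality for the seminorm of a positive semidefinite matrix. -/
lemma abs_dotProduct_mulVec_le (hA : A.PosSemidef) (u v : Fin d → ℝ) :
    |u ⬝ᵥ A *ᵥ v| ≤ weightedNorm A u * weightedNorm A v := by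
  have h (t : ℝ) : 0 ≤ (v ⬝ᵥ A *ᵥ v) * (t * t) + (2 * (u ⬝ᵥ A *ᵥ v)) * t + u ⬝ᵥ A *ᵥ u := by
    have := dotProduct_mulVec_self_nonneg hA (u + t • v)
    simp only [Matrix.mulVec_add, Matrix.mulVec_smul, dotProduct_add, add_dotProduct,
      dotProduct_smul, smul_dotProduct, smul_eq_mul] at this
    rw [dotProduct_mulVec_symm hA.isHermitian v u] at this
    linarith
  have h2 := discrim_le_zero h
  unfold discrim at h2
  unfold weightedNorm
  rw [← Real.sqrt_mul (dotProduct_mulVec_self_nonneg hA u)]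
  exact Real.abs_le_sqrt (by linarith)

lemma add_vecMulVec_posDef (hA : A.PosDef) (x : Fin d → ℝ) :
    (A + Matrix.vecMulVec x x).PosDef := by
  refine hA.add_posSemidef ?_
  simpa using Matrix.posSemidef_vecMulVec_self_star x

lemma add_vecMulVec_mulVec (x v : Fin d → ℝ) :
    (A + Matrix.vecMulVec x x) *ᵥ v = A *ᵥ v + (x ⬝ᵥ v) • x := by
  rw [Matrix.add_mulVec, Matrix.vecMulVec_mulVec]
  simp

lemma det_add_vecMulVec (hA : A.PosDef) (x : Fin d → ℝ) :
    (A + Matrix.vecMulVec x x).det = A.det * (1 + x ⬝ᵥ A⁻¹ *ᵥ x) := by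
  rw [Matrix.vecMulVec_eq Unit,
    Matrix.det_add_replicateCol_mul_replicateRow ((Matrix.isUnit_iff_isUnit_det _).1 hA.isUnit)]
  rw [Matrix.mul_assoc, ← Matrix.replicateCol_mulVec, Matrix.det_unique (n := Unit)]
  simp [Matrix.replicateRow_mul_replicateCol_apply]

/-- Effect of a rank-one update on the quadratic form of the inverse. -/
lemma quadForm_rankOne_update (hA : A.PosDef) (x S : Fin d → ℝ) (h : ℝ) :
    (S + h • x) ⬝ᵥ (A + Matrix.vecMulVec x x)⁻¹ *ᵥ (S + h • x) =
      S ⬝ᵥ A⁻¹ *ᵥ S + (2 * h * (x ⬝ᵥ A⁻¹ *ᵥ S) + h ^ 2 * (x ⬝ᵥ A⁻¹ *ᵥ x)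
        - (x ⬝ᵥ A⁻¹ *ᵥ S) ^ 2) / (1 + x ⬝ᵥ A⁻¹ *ᵥ x) := by
  have hw := dotProduct_mulVec_self_nonneg hA.inv.posSemidef x
  have hs : S ⬝ᵥ A⁻¹ *ᵥ x = x ⬝ᵥ A⁻¹ *ᵥ S := dotProduct_mulVec_symm hA.inv.isHermitian S x
  set w := x ⬝ᵥ A⁻¹ *ᵥ x with hwdef
  set a := x ⬝ᵥ A⁻¹ *ᵥ S with hadef
  have hw1 : (1 + w) ≠ 0 := by positivity
  -- Sherman-Morrison, verified by applying the updated matrix to the claimed solution.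
  have key : (A + Matrix.vecMulVec x x)⁻¹ *ᵥ (S + h • x) =
      A⁻¹ *ᵥ S + ((h - a) / (1 + w)) • (A⁻¹ *ᵥ x) := by
    refine inv_mulVec_eq (add_vecMulVec_posDef hA x) ?_
    rw [add_vecMulVec_mulVec, Matrix.mulVec_add, Matrix.mulVec_smul, mulVec_inv_mulVec hA,
      mulVec_inv_mulVec hA, dotProduct_add, dotProduct_smul, ← hwdef, ← hadef, add_assoc,
      ← add_smul]
    congr 2
    simp only [smul_eq_mul]
    field_simp
    ring
  rw [key]
  simp only [dotProduct_add, add_dotProduct, dotProduct_smul, smul_dotProduct, smul_eq_mul, hs,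
    ← hwdef, ← hadef]
  field_simp
  ring

/-- The determinant of a positive definite matrix is at most the `d`-th power of the mean of its
eigenvalues. -/
lemma det_le_trace_div_pow (hd : 1 ≤ d) (hA : A.PosDef) : A.det ≤ (A.trace / d) ^ d := by
  have hd0 : (0 : ℝ) < d := by exact_mod_cast hd
  have h1 := hA.isHermitian.det_eq_prod_eigenvalues
  have h2 := hA.isHermitian.trace_eq_sum_eigenvalues
  simp only [RCLike.ofReal_real_eq_id, id_eq] at h1 h2
  have h0 : ∀ i, 0 ≤ hA.isHermitian.eigenvalues i := fun i => (hA.eigenvalues_pos i).le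
  have := Real.geom_mean_le_arith_mean Finset.univ (fun _ => (1 : ℝ)) hA.isHermitian.eigenvalues
    (fun _ _ => zero_le_one) (by simpa using Nat.lt_of_lt_of_le one_pos hd) (fun i _ => h0 i)
  simp only [Real.rpow_one, Finset.sum_const, Finset.card_univ, Fintype.card_fin, nsmul_eq_mul,
    mul_one, one_mul] at this
  rw [h1, h2]
  have hp : 0 ≤ ∏ i, hA.isHermitian.eigenvalues i := Finset.prod_nonneg fun i _ => h0 i
  calc _ = ((∏ i, hA.isHermitian.eigenvalues i) ^ ((d : ℝ)⁻¹)) ^ d := by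
        rw [← Real.rpow_natCast, ← Real.rpow_mul hp, inv_mul_cancel₀ hd0.ne', Real.rpow_one]
    _ ≤ _ := pow_le_pow_left₀ (Real.rpow_nonneg hp _) this _

end RankOne

/-! ### Gram matrices, elliptical potential and least-squares error. -/

section Gram

variable {d : ℕ} (x : ℕ → Fin d → ℝ)

lemma gram_zero : gram x 0 = 1 := by simp [gram]

lemma gram_succ (t : ℕ) :
    gram x (t + 1) = gram x t + Matrix.vecMulVec (x (t + 1)) (x (t + 1)) := by
  simp [gram, Finset.sum_Icc_succ_top, add_assoc]

lemma gram_posDef (t : ℕ) : (gram x t).PosDef := by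
  induction t with
  | zero => rw [gram_zero]; exact Matrix.PosDef.one
  | succ t ih => rw [gram_succ]; exact add_vecMulVec_posDef ih _

lemma gram_mulVec (t : ℕ) (v : Fin d → ℝ) :
    gram x t *ᵥ v = v + ∑ s ∈ Finset.Icc 1 t, (x s ⬝ᵥ v) • x s := by
  induction t with
  | zero => simp [gram_zero]
  | succ t ih =>
    rw [gram_succ, add_vecMulVec_mulVec, ih, Finset.sum_Icc_succ_top (by omega), add_assoc]

lemma dotProduct_self_eq_euclNorm_sq (a : Fin d → ℝ) : a ⬝ᵥ a = euclNorm a ^ 2 := by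
  rw [euclNorm, EuclideanSpace.norm_sq_eq]
  simp [dotProduct, sq]

lemma euclNorm_nonneg (a : Fin d → ℝ) : 0 ≤ euclNorm a := norm_nonneg _

/-- The weighted norm squared of `a` splits along `I + ∑ x_s x_sᵀ`. -/
lemma quadForm_gram_inv (t : ℕ) (a : Fin d → ℝ) :
    a ⬝ᵥ (gram x t)⁻¹ *ᵥ a = euclNorm ((gram x t)⁻¹ *ᵥ a) ^ 2 +
      ∑ s ∈ Finset.Icc 1 t, (a ⬝ᵥ (gram x t)⁻¹ *ᵥ x s) ^ 2 := by
  have h := gram_mulVec x t ((gram x t)⁻¹ *ᵥ a)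
  rw [mulVec_inv_mulVec (gram_posDef x t)] at h
  calc a ⬝ᵥ (gram x t)⁻¹ *ᵥ a = ((gram x t)⁻¹ *ᵥ a) ⬝ᵥ a := dotProduct_comm _ _
    _ = ((gram x t)⁻¹ *ᵥ a) ⬝ᵥ ((gram x t)⁻¹ *ᵥ a +
        ∑ s ∈ Finset.Icc 1 t, (x s ⬝ᵥ ((gram x t)⁻¹ *ᵥ a)) • x s) := by rw [← h]
    _ = _ := by
      rw [dotProduct_add, dotProduct_self_eq_euclNorm_sq, dotProduct_sum]
      congr 1
      refine Finset.sum_congr rfl fun s _ => ?_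
      rw [dotProduct_smul, dotProduct_comm _ (x s),
        dotProduct_mulVec_symm (gram_posDef x t).inv.isHermitian (x s) a, smul_eq_mul, sq]

lemma abs_dotProduct_le_euclNorm (a b : Fin d → ℝ) : |a ⬝ᵥ b| ≤ euclNorm a * euclNorm b := by
  have := abs_dotProduct_mulVec_le (Matrix.PosSemidef.one (n := Fin d) (R := ℝ)) a b
  simpa [weightedNorm, dotProduct_self_eq_euclNorm_sq, Real.sqrt_sq (euclNorm_nonneg _)] using this

lemma weightedNorm_nonneg (A : Matrix (Fin d) (Fin d) ℝ) (a : Fin d → ℝ) :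
    0 ≤ weightedNorm A a := Real.sqrt_nonneg _

lemma weightedNorm_gram_inv_sq (t : ℕ) (a : Fin d → ℝ) :
    weightedNorm (gram x t)⁻¹ a ^ 2 = a ⬝ᵥ (gram x t)⁻¹ *ᵥ a :=
  Real.sq_sqrt (dotProduct_mulVec_self_nonneg (gram_posDef x t).inv.posSemidef a)

lemma weightedNorm_gram_inv_le_euclNorm (t : ℕ) (a : Fin d → ℝ) :
    weightedNorm (gram x t)⁻¹ a ≤ euclNorm a := by
  have h1 := weightedNorm_gram_inv_sq x t a
  have h2 := quadForm_gram_inv x t a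
  have h3 : 0 ≤ ∑ s ∈ Finset.Icc 1 t, (a ⬝ᵥ (gram x t)⁻¹ *ᵥ x s) ^ 2 :=
    Finset.sum_nonneg fun _ _ => sq_nonneg _
  have h4 := (le_abs_self _).trans (abs_dotProduct_le_euclNorm a ((gram x t)⁻¹ *ᵥ a))
  have h5 := euclNorm_nonneg ((gram x t)⁻¹ *ᵥ a)
  have h6 := euclNorm_nonneg a
  -- With `u = G⁻¹ a`, the splitting and Cauchy-Schwarz give `‖u‖² ≤ a ⬝ᵥ u ≤ ‖a‖ ‖u‖`.
  have h8 : euclNorm ((gram x t)⁻¹ *ᵥ a) ≤ euclNorm a := by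
    by_contra hc
    push Not at hc
    nlinarith
  refine abs_le_of_sq_le_sq' ?_ h6 |>.2
  nlinarith

/-- Cauchy-Schwarz over the rounds; the squares sum to at most `‖a‖²_{G⁻¹}` by `quadForm_gram_inv`.
This controls the misspecification bonus by the width. -/
lemma sum_abs_le_sqrt_mul_weightedNorm (t : ℕ) (a : Fin d → ℝ) :
    ∑ s ∈ Finset.Icc 1 t, |a ⬝ᵥ (gram x t)⁻¹ *ᵥ x s| ≤
      √t * weightedNorm (gram x t)⁻¹ a := by
  have h := sq_sum_le_card_mul_sum_sq (s := Finset.Icc 1 t)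
    (f := fun s => |a ⬝ᵥ (gram x t)⁻¹ *ᵥ x s|)
  simp only [sq_abs, Nat.card_Icc, Nat.add_sub_cancel] at h
  rw [weightedNorm, ← Real.sqrt_mul (Nat.cast_nonneg t)]
  refine Real.le_sqrt_of_sq_le (h.trans ?_)
  refine mul_le_mul_of_nonneg_left ?_ (Nat.cast_nonneg t)
  rw [quadForm_gram_inv x t a]
  linarith [sq_nonneg (euclNorm ((gram x t)⁻¹ *ᵥ a))]

lemma det_gram_succ (t : ℕ) : (gram x (t + 1)).det =
    (gram x t).det * (1 + x (t + 1) ⬝ᵥ (gram x t)⁻¹ *ᵥ x (t + 1)) := by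
  rw [gram_succ, det_add_vecMulVec (gram_posDef x t)]

lemma det_gram_le {n t : ℕ} (hd : 1 ≤ d) (htn : t ≤ n)
    (hx : ∀ s ∈ Finset.Icc 1 t, euclNorm (x s) ≤ 1) :
    (gram x t).det ≤ (1 + (n : ℝ) / d) ^ d := by
  have hd0 : (0 : ℝ) < d := by exact_mod_cast hd
  have htr : (gram x t).trace ≤ d + n := by
    rw [gram, Matrix.trace_add, Matrix.trace_sum, Matrix.trace_one, Fintype.card_fin]
    have : ∑ s ∈ Finset.Icc 1 t, (Matrix.vecMulVec (x s) (x s)).trace ≤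
        ∑ s ∈ Finset.Icc 1 t, (1 : ℝ) := by
      refine Finset.sum_le_sum fun s hs => ?_
      rw [Matrix.trace_vecMulVec, dotProduct_self_eq_euclNorm_sq]
      exact pow_le_one₀ (euclNorm_nonneg _) (hx s hs)
    simp only [Finset.sum_const, Nat.card_Icc, Nat.add_sub_cancel, nsmul_eq_mul, mul_one] at this
    have : (t : ℝ) ≤ n := by exact_mod_cast htn
    linarith
  have htr0 := (gram_posDef x t).posSemidef.trace_nonneg
  refine (det_le_trace_div_pow hd (gram_posDef x t)).trans ?_
  refine pow_le_pow_left₀ (by positivity) ?_ _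
  rw [div_le_iff₀ hd0]
  field_simp
  exact htr

/-- The elliptical potential lemma. -/
lemma sum_weightedNorm_sq_le_log_det (n : ℕ) (hx : ∀ s ∈ Finset.Icc 1 n, euclNorm (x s) ≤ 1) :
    ∑ t ∈ Finset.range n, weightedNorm (gram x t)⁻¹ (x (t + 1)) ^ 2 ≤
      2 * Real.log (gram x n).det := by
  induction n with
  | zero => simp [gram_zero]
  | succ n ih =>
    have hw := weightedNorm_gram_inv_sq x n (x (n + 1))
    have hw0 := weightedNorm_nonneg (gram x n)⁻¹ (x (n + 1))
    have hw1 : weightedNorm (gram x n)⁻¹ (x (n + 1)) ≤ 1 :=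
      (weightedNorm_gram_inv_le_euclNorm x n _).trans (hx _ (by simp))
    rw [Finset.sum_range_succ, det_gram_succ, ← hw,
      Real.log_mul (gram_posDef x n).det_pos.ne' (by positivity)]
    have := ih fun s hs => hx s (by simp at hs ⊢; omega)
    set w := weightedNorm (gram x n)⁻¹ (x (n + 1)) ^ 2
    have hwa : 0 ≤ w := by positivity
    have hwb : w ≤ 1 := pow_le_one₀ hw0 hw1
    have hlog := Real.one_sub_inv_le_log_of_pos (show 0 < 1 + w by positivity)
    -- This is where `w ≤ 1` enters; it gives `w ≤ 2 log (1 + w)`, and the logarithms telescope to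
    -- `log det`.
    have : w / 2 ≤ 1 - (1 + w)⁻¹ := by
      rw [inv_eq_one_div, le_sub_iff_add_le, ← le_sub_iff_add_le', div_le_iff₀ (by positivity)]
      nlinarith
    linarith

lemma sum_weightedNorm_le {n : ℕ} (hd : 1 ≤ d) (hx : ∀ s ∈ Finset.Icc 1 n, euclNorm (x s) ≤ 1) :
    ∑ t ∈ Finset.range n, weightedNorm (gram x t)⁻¹ (x (t + 1)) ≤
      √(n * (2 * (d * Real.log (1 + (n : ℝ) / d)))) := by
  have h := sq_sum_le_card_mul_sum_sq (s := Finset.range n)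
    (f := fun t => weightedNorm (gram x t)⁻¹ (x (t + 1)))
  rw [Finset.card_range] at h
  refine Real.le_sqrt_of_sq_le (h.trans ?_)
  refine mul_le_mul_of_nonneg_left ?_ (Nat.cast_nonneg n)
  refine (sum_weightedNorm_sq_le_log_det x n hx).trans ?_
  rw [← Real.log_pow]
  have := Real.log_le_log (gram_posDef x n).det_pos (det_gram_le x hd le_rfl hx)
  linarith

/-- Estimation error of the regularised least-squares estimator under misspecification. -/
lemma abs_estimator_error_le {ε : ℝ} {θ : Fin d → ℝ} {y e δ : ℕ → ℝ} {t : ℕ}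
    (hy : ∀ s ∈ Finset.Icc 1 t, y s = x s ⬝ᵥ θ + e s + δ s)
    (hδ : ∀ s ∈ Finset.Icc 1 t, |δ s| ≤ ε) (a : Fin d → ℝ) :
    |a ⬝ᵥ estimator x y t - a ⬝ᵥ θ| ≤ weightedNorm (gram x t)⁻¹ a *
      (weightedNorm (gram x t)⁻¹ (∑ s ∈ Finset.Icc 1 t, e s • x s) + euclNorm θ) +
      ε * ∑ s ∈ Finset.Icc 1 t, |a ⬝ᵥ (gram x t)⁻¹ *ᵥ x s| := by
  have hpd := gram_posDef x t
  -- The term `-θ` is the bias caused by the identity matrix in `G_t`.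
  have h1 : ∑ s ∈ Finset.Icc 1 t, y s • x s = gram x t *ᵥ θ - θ +
      (∑ s ∈ Finset.Icc 1 t, e s • x s) + ∑ s ∈ Finset.Icc 1 t, δ s • x s := by
    rw [gram_mulVec, add_sub_cancel_left, ← Finset.sum_add_distrib, ← Finset.sum_add_distrib]
    refine Finset.sum_congr rfl fun s hs => ?_
    rw [hy s hs, add_smul, add_smul]
  have h2 : a ⬝ᵥ estimator x y t - a ⬝ᵥ θ =
      a ⬝ᵥ (gram x t)⁻¹ *ᵥ (∑ s ∈ Finset.Icc 1 t, e s • x s) - a ⬝ᵥ (gram x t)⁻¹ *ᵥ θ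
        + ∑ s ∈ Finset.Icc 1 t, δ s * (a ⬝ᵥ (gram x t)⁻¹ *ᵥ x s) := by
    rw [estimator, h1, Matrix.mulVec_add, Matrix.mulVec_add, Matrix.mulVec_sub,
      inv_mulVec_eq hpd rfl, Matrix.mulVec_sum _ (Finset.Icc 1 t) fun s => δ s • x s]
    simp only [dotProduct_add, dotProduct_sub, dotProduct_sum, Matrix.mulVec_smul,
      dotProduct_smul, smul_eq_mul]
    ring
  have h3 := abs_dotProduct_mulVec_le hpd.inv.posSemidef a (∑ s ∈ Finset.Icc 1 t, e s • x s)
  have h4 : |a ⬝ᵥ (gram x t)⁻¹ *ᵥ θ| ≤ weightedNorm (gram x t)⁻¹ a * euclNorm θ :=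
    (abs_dotProduct_mulVec_le hpd.inv.posSemidef a θ).trans
      (mul_le_mul_of_nonneg_left (weightedNorm_gram_inv_le_euclNorm x t θ) (weightedNorm_nonneg _ _))
  have h5 : |∑ s ∈ Finset.Icc 1 t, δ s * (a ⬝ᵥ (gram x t)⁻¹ *ᵥ x s)| ≤
      ε * ∑ s ∈ Finset.Icc 1 t, |a ⬝ᵥ (gram x t)⁻¹ *ᵥ x s| := by
    refine (Finset.abs_sum_le_sum_abs _ _).trans ?_
    rw [Finset.mul_sum]
    refine Finset.sum_le_sum fun s hs => ?_
    rw [abs_mul]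
    exact mul_le_mul_of_nonneg_right (hδ s hs) (abs_nonneg _)
  rw [h2]
  refine (abs_add_le _ _).trans ?_
  have := abs_sub (a ⬝ᵥ (gram x t)⁻¹ *ᵥ (∑ s ∈ Finset.Icc 1 t, e s • x s))
    (a ⬝ᵥ (gram x t)⁻¹ *ᵥ θ)
  linarith

end Gram

/-! ### Gaussian mixtures of exponential supermartingales. -/

section Mixture

open scoped NNReal ENNReal

/-- The average of `exp (l * h - l ^ 2 / 2)` over a Gaussian variable `l` of mean `m` and
variance `w`. -/
noncomputable def gaussMixture (m : ℝ) (w : ℝ≥0) (h : ℝ) : ℝ :=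
  Real.exp ((2 * h * m + h ^ 2 * w - m ^ 2) / (2 * (1 + w))) / √(1 + w)

lemma lintegral_exp_gaussianReal (m h : ℝ) (w : ℝ≥0) :
    ∫⁻ l, ENNReal.ofReal (Real.exp (l * h - l ^ 2 / 2)) ∂(gaussianReal m w) =
      ENNReal.ofReal (gaussMixture m w h) := by
  -- Variance zero does occur, when the zero vector is played; the Gaussian is then a Dirac mass.
  by_cases hw : w = 0
  · subst hw
    rw [gaussianReal_zero_var, lintegral_dirac]
    congr 1
    simp only [gaussMixture, NNReal.coe_zero, mul_zero, add_zero, mul_one, Real.sqrt_one, div_one]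
    congr 1
    ring
  have hw0 : (0 : ℝ) < w := by exact_mod_cast pos_iff_ne_zero.2 hw
  rw [gaussianReal_of_var_ne_zero _ hw, lintegral_withDensity_eq_lintegral_mul _ (by fun_prop)
    (by fun_prop)]
  have hv : w / (1 + w) ≠ 0 := by positivity
  -- Completing the square: the integrand is a constant times another Gaussian density.
  have key (l : ℝ) : gaussianPDF m w l * ENNReal.ofReal (Real.exp (l * h - l ^ 2 / 2)) =
      ENNReal.ofReal (gaussMixture m w h) *
        ENNReal.ofReal (gaussianPDFReal ((m + h * w) / (1 + w)) (w / (1 + w)) l) := by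
    rw [gaussianPDF, ← ENNReal.ofReal_mul (gaussianPDFReal_nonneg _ _ _),
      ← ENNReal.ofReal_mul (by unfold gaussMixture; positivity)]
    congr 1
    unfold gaussianPDFReal gaussMixture
    have hs : √(2 * Real.pi * ((w / (1 + w) : ℝ≥0) : ℝ)) = √(2 * Real.pi * w) / √(1 + w) := by
      rw [← Real.sqrt_div (by positivity)]
      congr 1
      push_cast
      ring
    have he : Real.exp (-(l - m) ^ 2 / (2 * w)) * Real.exp (l * h - l ^ 2 / 2) =
        Real.exp ((2 * h * m + h ^ 2 * w - m ^ 2) / (2 * (1 + w))) *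
          Real.exp (-(l - (m + h * w) / (1 + w)) ^ 2 / (2 * ((w / (1 + w) : ℝ≥0) : ℝ))) := by
      rw [← Real.exp_add, ← Real.exp_add]
      congr 1
      push_cast
      field_simp
      ring
    have h1 : √(1 + (w : ℝ)) ≠ 0 := by positivity
    have h2 : √(2 * Real.pi * w) ≠ 0 := by positivity
    rw [hs, mul_assoc, he]
    field_simp
  simp only [Pi.mul_apply, key]
  rw [lintegral_const_mul _ (by fun_prop), lintegral_gaussianPDFReal_eq_one _ hv, mul_one]

lemma measurable_gaussMixture {α : Type*} [MeasurableSpace α] {f h : α → ℝ} {w : α → ℝ≥0}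
    (hf : Measurable f) (hw : Measurable w) (hh : Measurable h) :
    Measurable fun z => gaussMixture (f z) (w z) (h z) := by
  unfold gaussMixture
  fun_prop

variable {Ω : Type*} {m mΩ : MeasurableSpace Ω} {P : Measure Ω}

/-- By Tonelli it suffices to fix `l`, and `exp (l η - l² / 2)` has mean at most one by
subgaussianity. -/
lemma lintegral_gaussMixture_le_one [IsProbabilityMeasure P] {η : Ω → ℝ} (hm : Measurable η)
    (hη : HasSubgaussianMGF η 1 P) (b : ℝ) (w : ℝ≥0) :
    ∫⁻ ω, ENNReal.ofReal (gaussMixture b w (η ω)) ∂P ≤ 1 := by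
  simp_rw [← lintegral_exp_gaussianReal]
  rw [lintegral_lintegral_swap (by fun_prop)]
  calc _ ≤ ∫⁻ _, 1 ∂(gaussianReal b w) := by
        refine lintegral_mono fun l => ?_
        have h1 (ω : Ω) : Real.exp (l * η ω - l ^ 2 / 2) =
            Real.exp (-(l ^ 2 / 2)) * Real.exp (l * η ω) := by
          rw [← Real.exp_add]; congr 1; ring
        have hmgf := hη.mgf_le l
        simp_rw [h1, ENNReal.ofReal_mul (Real.exp_nonneg _)]
        rw [lintegral_const_mul _ (by fun_prop), ← ofReal_integral_eq_lintegral_ofReal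
          (hη.integrable_exp_mul l) (ae_of_all _ fun _ => (Real.exp_nonneg _)),
          ← ENNReal.ofReal_mul (Real.exp_nonneg _), ← ENNReal.ofReal_one]
        refine ENNReal.ofReal_le_ofReal ?_
        calc _ ≤ Real.exp (-(l ^ 2 / 2)) * Real.exp ((1 : ℝ≥0) * l ^ 2 / 2) :=
              mul_le_mul_of_nonneg_left hmgf (Real.exp_nonneg _)
          _ = 1 := by rw [← Real.exp_add]; simp
    _ = 1 := by simp

/-- One step of the method of mixtures: multiplying by the Gaussian mixture with parameters from
the past does not increase the mean. -/
lemma lintegral_mul_gaussMixture_le [IsProbabilityMeasure P] (hle : m ≤ mΩ)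
    {η : Ω → ℝ} (hm : Measurable η) (hη : HasSubgaussianMGF η 1 P)
    (hind : Indep (MeasurableSpace.comap η inferInstance) m P)
    {M : Ω → ℝ≥0∞} {a : Ω → ℝ} {w : Ω → ℝ≥0} (hM : Measurable[m] M) (ha : Measurable[m] a)
    (hw : Measurable[m] w) :
    ∫⁻ ω, M ω * ENNReal.ofReal (gaussMixture (a ω) (w ω) (η ω)) ∂P ≤ ∫⁻ ω, M ω ∂P := by
  have hZm : Measurable[m] fun ω => (M ω, a ω, w ω) := hM.prodMk (ha.prodMk hw)
  have hZ : Measurable fun ω => (M ω, a ω, w ω) := hZm.mono hle le_rfl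
  -- Independence makes the joint law a product, so the parameters from the past can be frozen while
  -- `η` is integrated.
  have hI : IndepFun (fun ω => (M ω, a ω, w ω)) η P := by
    rw [IndepFun_iff_Indep]
    exact (indep_of_indep_of_le_right hind hZm.comap_le).symm
  rw [indepFun_iff_map_prod_eq_prod_map_map hZ.aemeasurable hm.aemeasurable] at hI
  have hF : Measurable fun p : (ℝ≥0∞ × ℝ × ℝ≥0) × ℝ =>
      p.1.1 * ENNReal.ofReal (gaussMixture p.1.2.1 p.1.2.2 p.2) :=
    (measurable_fst.comp measurable_fst).mul (measurable_gaussMixture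
      (measurable_fst.comp (measurable_snd.comp measurable_fst))
      (measurable_snd.comp (measurable_snd.comp measurable_fst)) measurable_snd).ennreal_ofReal
  have hprob : IsProbabilityMeasure (P.map η) := Measure.isProbabilityMeasure_map hm.aemeasurable
  calc _ = ∫⁻ p, p.1.1 * ENNReal.ofReal (gaussMixture p.1.2.1 p.1.2.2 p.2)
        ∂(P.map fun ω => ((M ω, a ω, w ω), η ω)) := by
        rw [lintegral_map hF (hZ.prodMk hm)]
    _ = ∫⁻ z, ∫⁻ h, z.1 * ENNReal.ofReal (gaussMixture z.2.1 z.2.2 h) ∂(P.map η)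
        ∂(P.map fun ω => (M ω, a ω, w ω)) := by
        rw [hI, lintegral_prod _ hF.aemeasurable]
    _ ≤ ∫⁻ z, z.1 ∂(P.map fun ω => (M ω, a ω, w ω)) := by
        refine lintegral_mono fun z => ?_
        have hg : Measurable fun h => ENNReal.ofReal (gaussMixture z.2.1 z.2.2 h) :=
          (measurable_gaussMixture measurable_const measurable_const measurable_id).ennreal_ofReal
        rw [lintegral_const_mul _ hg, lintegral_map hg hm]
        exact mul_le_of_le_one_right' (lintegral_gaussMixture_le_one hm hη _ _)
    _ = _ := lintegral_map measurable_fst hZ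

end Mixture

/-! ### Measurability of matrix expressions. -/

section Measurability

variable {Ω : Type*} {m : MeasurableSpace Ω} {d : ℕ}

lemma measurable_det {A : Ω → Matrix (Fin d) (Fin d) ℝ} (hA : ∀ i j, Measurable fun ω => A ω i j) :
    Measurable fun ω => (A ω).det := by
  simp only [Matrix.det_apply]
  refine Finset.measurable_sum _ fun σ _ => ?_
  refine Measurable.const_smul (Finset.measurable_prod _ fun i _ => hA _ _) _

/-- By Cramer's rule each entry is a determinant divided by a determinant. -/
lemma measurable_inv_apply {A : Ω → Matrix (Fin d) (Fin d) ℝ}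
    (hA : ∀ i j, Measurable fun ω => A ω i j) (i j : Fin d) :
    Measurable fun ω => (A ω)⁻¹ i j := by
  simp only [Matrix.inv_def, Ring.inverse_eq_inv', Matrix.smul_apply, smul_eq_mul,
    Matrix.adjugate_apply]
  refine (measurable_det hA).inv.mul (measurable_det fun k l => ?_)
  by_cases h : k = j
  · subst h
    simp only [Matrix.updateRow_self]
    exact measurable_const
  · simp only [Matrix.updateRow_ne h]
    exact hA _ _

lemma measurable_dotProduct_mulVec {A : Ω → Matrix (Fin d) (Fin d) ℝ} {u v : Ω → Fin d → ℝ}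
    (hA : ∀ i j, Measurable fun ω => A ω i j) (hu : Measurable u) (hv : Measurable v) :
    Measurable fun ω => u ω ⬝ᵥ A ω *ᵥ v ω := by
  simp only [dotProduct, Matrix.mulVec]
  refine Finset.measurable_sum _ fun i _ => ((measurable_pi_apply i).comp hu).mul ?_
  exact Finset.measurable_sum _ fun j _ => (hA i j).mul ((measurable_pi_apply j).comp hv)

lemma measurable_gram_apply {X : ℕ → Ω → Fin d → ℝ} {t : ℕ}
    (hX : ∀ s ∈ Finset.Icc 1 t, Measurable (X s)) (i j : Fin d) :
    Measurable fun ω => gram (fun s => X s ω) t i j := by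
  simp only [gram, Matrix.add_apply, Matrix.sum_apply, Matrix.vecMulVec_apply]
  refine measurable_const.add (Finset.measurable_sum _ fun s hs => ?_)
  exact ((measurable_pi_apply i).comp (hX s hs)).mul ((measurable_pi_apply j).comp (hX s hs))

end Measurability

/-! ### Self-normalised concentration of the noise. -/

section Concentration

open scoped NNReal ENNReal

variable {Ω : Type*} {mΩ : MeasurableSpace Ω} {P : Measure Ω} {d : ℕ}

/-- The noise part `∑_{s=1}^t e_s x_s` of the least-squares estimator. -/
def noiseSum (x : ℕ → Fin d → ℝ) (e : ℕ → ℝ) (t : ℕ) : Fin d → ℝ :=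
  ∑ s ∈ Finset.Icc 1 t, e s • x s

/-- The self-normalised process `exp (‖S_t‖²_{G_t⁻¹} / 2) / √(det G_t)`. -/
noncomputable def selfNormalized (x : ℕ → Fin d → ℝ) (e : ℕ → ℝ) (t : ℕ) : ℝ :=
  Real.exp ((noiseSum x e t ⬝ᵥ (gram x t)⁻¹ *ᵥ noiseSum x e t) / 2) / √(gram x t).det

/-- The process is the average of `exp (⟨v, S_t⟩ - ∑ ⟨v, x_s⟩² / 2)` over a standard Gaussian `v`.
Tilted by this weight, `v` has law `N(G_t⁻¹ S_t, G_t⁻¹)`, so `⟨v, x_{t+1}⟩` is Gaussian with the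
mean and variance below, and a one-dimensional mixture is all that each step needs. -/
lemma selfNormalized_succ (x : ℕ → Fin d → ℝ) (e : ℕ → ℝ) (t : ℕ) :
    selfNormalized x e (t + 1) = selfNormalized x e t *
      gaussMixture (x (t + 1) ⬝ᵥ (gram x t)⁻¹ *ᵥ noiseSum x e t)
        (x (t + 1) ⬝ᵥ (gram x t)⁻¹ *ᵥ x (t + 1)).toNNReal (e (t + 1)) := by
  have hpd := gram_posDef x t
  have hw := dotProduct_mulVec_self_nonneg hpd.inv.posSemidef (x (t + 1))
  have hS : noiseSum x e (t + 1) = noiseSum x e t + e (t + 1) • x (t + 1) := by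
    simp [noiseSum, Finset.sum_Icc_succ_top]
  unfold selfNormalized gaussMixture
  rw [hS, det_gram_succ, gram_succ, quadForm_rankOne_update hpd, Real.coe_toNNReal _ hw, add_div,
    Real.exp_add, Real.sqrt_mul hpd.det_pos.le, div_div, mul_comm (1 + _) (2 : ℝ), mul_div_mul_comm]

section

variable {X : ℕ → Ω → Fin d → ℝ} {η : ℕ → Ω → ℝ} {t : ℕ}

lemma measurable_noiseSum (hX : ∀ s ∈ Finset.Icc 1 t, Measurable (X s))
    (hη : ∀ s ∈ Finset.Icc 1 t, Measurable (η s)) :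
    Measurable fun ω => noiseSum (fun s => X s ω) (fun s => η s ω) t := by
  unfold noiseSum
  exact Finset.measurable_sum _ fun s hs => (hη s hs).smul (hX s hs)

lemma measurable_quadForm_noiseSum (hX : ∀ s ∈ Finset.Icc 1 t, Measurable (X s))
    (hη : ∀ s ∈ Finset.Icc 1 t, Measurable (η s)) :
    Measurable fun ω => noiseSum (fun s => X s ω) (fun s => η s ω) t ⬝ᵥ
      (gram (fun s => X s ω) t)⁻¹ *ᵥ noiseSum (fun s => X s ω) (fun s => η s ω) t :=
  measurable_dotProduct_mulVec (measurable_inv_apply (measurable_gram_apply hX))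
    (measurable_noiseSum hX hη) (measurable_noiseSum hX hη)

lemma measurable_selfNormalized (hX : ∀ s ∈ Finset.Icc 1 t, Measurable (X s))
    (hη : ∀ s ∈ Finset.Icc 1 t, Measurable (η s)) :
    Measurable fun ω => selfNormalized (fun s => X s ω) (fun s => η s ω) t :=
  ((measurable_quadForm_noiseSum hX hη).div_const 2).exp.div
    (measurable_det (measurable_gram_apply hX)).sqrt

end

variable [IsProbabilityMeasure P] {n : ℕ} {ℱ : Filtration ℕ mΩ} {X : ℕ → Ω → Fin d → ℝ}
  {η : ℕ → Ω → ℝ}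

/-- The self-normalised process has mean at most one. -/
lemma lintegral_selfNormalized_le_one (hη : ∀ t ∈ Finset.Icc 1 n, Measurable[ℱ t] (η t))
    (hind : ∀ t < n, Indep (MeasurableSpace.comap (η (t + 1)) inferInstance) (ℱ t) P)
    (hsub : ∀ t ∈ Finset.Icc 1 n, HasSubgaussianMGF (η t) 1 P)
    (hX : ∀ t < n, Measurable[ℱ t] (X (t + 1))) {t : ℕ} (ht : t ≤ n) :
    ∫⁻ ω, ENNReal.ofReal (selfNormalized (fun s => X s ω) (fun s => η s ω) t) ∂P ≤ 1 := by
  induction t with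
  | zero => simp [selfNormalized, noiseSum, gram_zero]
  | succ t ih =>
    refine le_trans ?_ (ih (by omega))
    have hXm : ∀ s ∈ Finset.Icc 1 (t + 1), Measurable[ℱ t] (X s) := by
      intro s hs
      rw [Finset.mem_Icc] at hs
      obtain ⟨s, rfl⟩ : ∃ r, s = r + 1 := ⟨s - 1, by omega⟩
      exact (hX s (by omega)).mono (ℱ.mono (by omega)) le_rfl
    have hXt : ∀ s ∈ Finset.Icc 1 t, Measurable[ℱ t] (X s) :=
      fun s hs => hXm s (by rw [Finset.mem_Icc] at hs ⊢; omega)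
    have hηt : ∀ s ∈ Finset.Icc 1 t, Measurable[ℱ t] (η s) := fun s hs =>
      (hη s (by rw [Finset.mem_Icc] at hs ⊢; omega)).mono (ℱ.mono (Finset.mem_Icc.1 hs).2) le_rfl
    have hXl : Measurable[ℱ t] (X (t + 1)) := hXm _ (by simp)
    have hG := measurable_inv_apply (m := ℱ t) (measurable_gram_apply (m := ℱ t) hXt)
    have hmem : t + 1 ∈ Finset.Icc 1 n := by rw [Finset.mem_Icc]; omega
    simp_rw [selfNormalized_succ]
    have hnn (ω : Ω) : 0 ≤ selfNormalized (fun s => X s ω) (fun s => η s ω) t := by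
      unfold selfNormalized; positivity
    simp_rw [ENNReal.ofReal_mul (hnn _)]
    exact lintegral_mul_gaussMixture_le (ℱ.le t) ((hη _ hmem).mono (ℱ.le (t + 1)) le_rfl)
      (hsub _ hmem) (hind t (by omega))
      (measurable_selfNormalized (mΩ := ℱ t) hXt hηt).ennreal_ofReal
      (measurable_dotProduct_mulVec hG hXl (measurable_noiseSum (mΩ := ℱ t) hXt hηt))
      (measurable_dotProduct_mulVec hG hXl hXl).real_toNNReal

/-- The event that the noise part of the estimation error exceeds the level `u` after `t`
rounds. -/
def largeNoise (X : ℕ → Ω → Fin d → ℝ) (η : ℕ → Ω → ℝ) (u : ℝ) (t : ℕ) : Set Ω :=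
  {ω | u < weightedNorm (gram (fun s => X s ω) t)⁻¹
    (noiseSum (fun s => X s ω) (fun s => η s ω) t)}

/-- Self-normalised concentration at a fixed time: with `s = β - 1`, the noise exceeds `s - ρ`
with probability at most `exp (ρ s) / n`. -/
lemma measure_largeNoise_le (hd : 1 ≤ d) (hn : 1 ≤ n)
    (hη : ∀ t ∈ Finset.Icc 1 n, Measurable[ℱ t] (η t))
    (hind : ∀ t < n, Indep (MeasurableSpace.comap (η (t + 1)) inferInstance) (ℱ t) P)
    (hsub : ∀ t ∈ Finset.Icc 1 n, HasSubgaussianMGF (η t) 1 P)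
    (hX : ∀ t < n, Measurable[ℱ t] (X (t + 1)))
    (hX1 : ∀ t ∈ Finset.Icc 1 n, ∀ ω, euclNorm (X t ω) ≤ 1) {ρ : ℝ} (hρ : 0 ≤ ρ)
    {t : ℕ} (ht : t ≤ n) :
    MeasurableSet (largeNoise X η (confWidth n d - 1 - ρ) t) ∧
      P.real (largeNoise X η (confWidth n d - 1 - ρ) t) ≤
        Real.exp (ρ * (confWidth n d - 1)) / n := by
  have hXt : ∀ s ∈ Finset.Icc 1 t, Measurable (X s) := by
    intro s hs
    rw [Finset.mem_Icc] at hs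
    obtain ⟨s, rfl⟩ : ∃ r, s = r + 1 := ⟨s - 1, by omega⟩
    exact (hX s (by omega)).mono (ℱ.le _) le_rfl
  have hηt : ∀ s ∈ Finset.Icc 1 t, Measurable (η s) := fun s hs =>
    (hη s (by rw [Finset.mem_Icc] at hs ⊢; omega)).mono (ℱ.le _) le_rfl
  refine ⟨measurableSet_lt measurable_const (measurable_quadForm_noiseSum hXt hηt).sqrt, ?_⟩
  set s := confWidth n d - 1 with hs
  have hn0 : (0 : ℝ) < n := by exact_mod_cast hn
  have hlogn : 0 ≤ Real.log n := Real.log_nonneg (by exact_mod_cast hn)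
  have hD1 : 1 ≤ 1 + (n : ℝ) / d := le_add_of_nonneg_right (by positivity)
  have hlogD := Real.log_nonneg hD1
  have hs0 : 0 ≤ s := by rw [hs, confWidth, add_sub_cancel_left]; exact Real.sqrt_nonneg _
  have hs2 : s ^ 2 = 2 * Real.log n + d * Real.log (1 + (n : ℝ) / d) := by
    rw [hs, confWidth, add_sub_cancel_left, Real.sq_sqrt (by positivity)]
  set c := n * Real.exp (-(ρ * s)) with hc
  have hc0 : 0 < c := by positivity
  have hsubset : largeNoise X η (s - ρ) t ⊆ {ω | ENNReal.ofReal c ≤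
      ENNReal.ofReal (selfNormalized (fun s => X s ω) (fun s => η s ω) t)} := by
    intro ω hω
    refine ENNReal.ofReal_le_ofReal ?_
    simp only [largeNoise, Set.mem_ofPred_eq] at hω
    have hdet0 := (gram_posDef (fun s => X s ω) t).det_pos
    have hdet := det_gram_le (fun s => X s ω) (n := n) hd ht fun r hr =>
      hX1 r (by rw [Finset.mem_Icc] at hr ⊢; omega) ω
    have hN := weightedNorm_gram_inv_sq (fun s => X s ω) t
      (noiseSum (fun s => X s ω) (fun s => η s ω) t)
    have hN0 := weightedNorm_nonneg (gram (fun s => X s ω) t)⁻¹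
      (noiseSum (fun s => X s ω) (fun s => η s ω) t)
    unfold selfNormalized
    rw [← hN]
    set N := weightedNorm (gram (fun s => X s ω) t)⁻¹
      (noiseSum (fun s => X s ω) (fun s => η s ω) t)
    -- If `ρ ≤ s`, square `N > s - ρ ≥ 0`; otherwise the left side is at most `-s²`.
    have hquad : s ^ 2 - 2 * (ρ * s) ≤ N ^ 2 := by
      rcases le_total ρ s with h | h <;> nlinarith
    have hlogdet : Real.log (gram (fun s => X s ω) t).det ≤ d * Real.log (1 + (n : ℝ) / d) := by
      rw [← Real.log_pow]
      exact Real.log_le_log hdet0 hdet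
    -- In `s² / 2`, the summand `log n` produces the factor `n` and the other summand cancels
    -- `√det`.
    rw [le_div_iff₀ (Real.sqrt_pos.2 hdet0), hc]
    have h1 : (n : ℝ) = Real.exp (Real.log n) := (Real.exp_log hn0).symm
    have h2 : √(gram (fun s => X s ω) t).det =
        Real.exp (Real.log (gram (fun s => X s ω) t).det / 2) := by
      rw [Real.exp_half, Real.exp_log hdet0]
    rw [h2, h1, ← Real.exp_add, ← Real.exp_add]
    refine Real.exp_le_exp.2 ?_
    linarith
  have hmarkov := (mul_meas_ge_le_lintegral (μ := P)
    (measurable_selfNormalized hXt hηt).ennreal_ofReal (ENNReal.ofReal c)).trans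
    (lintegral_selfNormalized_le_one hη hind hsub hX ht)
  have hfin : ENNReal.ofReal c * P (largeNoise X η (s - ρ) t) ≤ 1 :=
    (mul_le_mul_right (measure_mono hsubset) _).trans hmarkov
  have hreal : c * P.real (largeNoise X η (s - ρ) t) ≤ 1 := by
    have := ENNReal.toReal_mono ENNReal.one_ne_top hfin
    rwa [ENNReal.toReal_mul, ENNReal.toReal_ofReal hc0.le, ENNReal.toReal_one] at this
  rw [hc, Real.exp_neg] at hreal
  rw [le_div_iff₀ hn0]
  have he := Real.exp_pos (ρ * s)
  calc _ = (n * (Real.exp (ρ * s))⁻¹ * P.real (largeNoise X η (s - ρ) t)) * Real.exp (ρ * s) := by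
        field_simp
    _ ≤ 1 * Real.exp (ρ * s) := mul_le_mul_of_nonneg_right hreal he.le
    _ = _ := one_mul _

end Concentration

/-! ### Regret of one round, and the numerical estimate. -/

section Regret

variable {d : ℕ}

/-- On the confidence event, an action whose index is at least that of `a` is nearly as good. -/
lemma meanReward_sub_le {n t : ℕ} {ε : ℝ} {θ : Fin d → ℝ} {Δ : (Fin d → ℝ) → ℝ}
    (hΔ : ∀ a, |Δ a| ≤ ε) {x : ℕ → Fin d → ℝ} {y e : ℕ → ℝ}
    (hy : ∀ s ∈ Finset.Icc 1 t, y s = x s ⬝ᵥ θ + e s + Δ (x s))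
    (hconf : weightedNorm (gram x t)⁻¹ (noiseSum x e t) + euclNorm θ ≤ confWidth n d)
    {a b : Fin d → ℝ} (hab : ucbIndex n ε x y t a ≤ ucbIndex n ε x y t b) :
    meanReward θ Δ a - meanReward θ Δ b ≤
      2 * ε + 2 * (confWidth n d + ε * √t) * weightedNorm (gram x t)⁻¹ b := by
  have hε : 0 ≤ ε := (abs_nonneg _).trans (hΔ 0)
  have herr := abs_estimator_error_le x hy fun s _ => hΔ (x s)
  -- Optimism: the index of `a` exceeds `⟨a, θ⟩`, while that of `b` exceeds `⟨b, θ⟩` by at most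
  -- twice its bonus.
  have ha := (abs_le.1 (herr a)).1
  have hb := (abs_le.1 (herr b)).2
  have hca := mul_le_mul_of_nonneg_left hconf (weightedNorm_nonneg (gram x t)⁻¹ a)
  have hcb := mul_le_mul_of_nonneg_left hconf (weightedNorm_nonneg (gram x t)⁻¹ b)
  have hsum := mul_le_mul_of_nonneg_left (sum_abs_le_sqrt_mul_weightedNorm x t b) hε
  have hΔa := (abs_le.1 (hΔ a)).2
  have hΔb := (abs_le.1 (hΔ b)).1
  unfold ucbIndex at hab
  unfold noiseSum at hca hcb
  unfold meanReward
  nlinarith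

/-- Elementary estimate combining the regret on the confidence events with the regret outside. -/
lemma regret_bound_numeric {n : ℕ} (hd : 1 ≤ d) (hn : 2 ≤ n) {ε ρ p : ℝ} (hε : 0 ≤ ε)
    (hp1 : p ≤ n) (hp : p ≤ Real.exp (ρ * (confWidth n d - 1))) :
    n * (2 * ε) + 2 * (confWidth n d + ε * √n) *
        √(n * (2 * (d * Real.log (1 + (n : ℝ) / d)))) + (2 + 2 * ε) * p ≤
      24 * Real.exp ((1 + d) * ρ ^ 2) *
        (d * √n * Real.log n + n * ε * √(d * Real.log n)) := by
  have hd1 : (1 : ℝ) ≤ d := by exact_mod_cast hd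
  have hn2 : (2 : ℝ) ≤ n := by exact_mod_cast hn
  have hL : 1 / 2 ≤ Real.log n :=
    (by linarith [Real.log_two_gt_d9] : (1 : ℝ) / 2 ≤ Real.log 2).trans
      (Real.log_le_log (by norm_num) hn2)
  have hl : Real.log (1 + (n : ℝ) / d) ≤ 2 * Real.log n := by
    have h1 : (n : ℝ) / d ≤ n := div_le_self (by linarith) hd1
    rw [show 2 * Real.log (n : ℝ) = Real.log ((n : ℝ) ^ 2) by simp [Real.log_pow]]
    exact Real.log_le_log (by positivity) (by nlinarith)
  set L := Real.log (n : ℝ)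
  set l := Real.log (1 + (n : ℝ) / d)
  set s := confWidth n d - 1 with hs
  have hs' : s = √(2 * L + d * l) := by rw [hs, confWidth, add_sub_cancel_left]
  have hl0 : 0 ≤ l := Real.log_nonneg (le_add_of_nonneg_right (by positivity))
  have hs2 : s ^ 2 ≤ 2 * (1 + d) * L := by
    rw [hs', Real.sq_sqrt (by positivity)]
    nlinarith
  have hs0 : 0 ≤ s := hs' ▸ Real.sqrt_nonneg _
  have hdL : L ≤ d * L := by nlinarith
  set q := √(d * L) with hq
  have hq0 : 0 ≤ q := Real.sqrt_nonneg _
  have hq2 : q ^ 2 = d * L := Real.sq_sqrt (by nlinarith)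
  have hq1 : 1 ≤ 2 * q := by nlinarith
  have hsq : s ≤ 2 * q := abs_le_of_sq_le_sq' (by nlinarith) (by positivity) |>.2
  have hβ : confWidth n d ≤ 4 * q := by linarith
  set r := √(n : ℝ)
  have hr0 : 0 ≤ r := Real.sqrt_nonneg _
  have hr2 : r ^ 2 = n := Real.sq_sqrt (by positivity)
  have hroot : √(n * (2 * (d * l))) ≤ 2 * r * q := by
    rw [Real.sqrt_le_left (by positivity), mul_pow, mul_pow, hr2, hq2]
    have : (d : ℝ) * l ≤ d * (2 * L) := by gcongr
    nlinarith
  set K := Real.exp ((1 + d) * ρ ^ 2)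
  have hK : 1 ≤ K := Real.one_le_exp (by positivity)
  have hpK : p ≤ K * r := by
    refine hp.trans ?_
    have hr : r = Real.exp (L / 2) := by
      rw [Real.exp_half, Real.exp_log (by linarith)]
    rw [hr, ← Real.exp_add]
    refine Real.exp_le_exp.2 ?_
    -- AM-GM, weighted so that the `s²` term is at most `L / 2 = log √n`.
    have h1 : ρ * s ≤ (1 + d) * ρ ^ 2 + s ^ 2 / (4 * (1 + d)) := by
      have h := sq_nonneg (2 * (1 + d) * ρ - s)
      rw [← sub_nonneg]
      have : (1 + d) * ρ ^ 2 + s ^ 2 / (4 * (1 + d)) - ρ * s =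
          (2 * (1 + d) * ρ - s) ^ 2 / (4 * (1 + d)) := by field_simp; ring
      rw [this]
      positivity
    have h2 : s ^ 2 / (4 * (1 + d)) ≤ L / 2 := by
      rw [div_le_iff₀ (by positivity)]
      linarith
    linarith
  have hmain : 2 * (confWidth n d + ε * r) * √(n * (2 * (d * l))) ≤
      16 * (d * r * L) + 4 * (n * ε * q) := by
    calc _ ≤ 2 * (4 * q + ε * r) * (2 * r * q) := by gcongr
      _ = 16 * (r * q ^ 2) + 4 * (r ^ 2 * ε * q) := by ring
      _ = _ := by rw [hq2, hr2]; ring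
  have hnε : 0 ≤ n * ε := by positivity
  have h3 : n * ε ≤ 2 * (n * ε * q) := by nlinarith
  -- For the part with `ε` the trivial bound `p ≤ n` is enough.
  have h4 : ε * p ≤ n * ε := by nlinarith
  have h5 : K * r ≤ 2 * (K * (d * r * L)) := by
    have : 0 ≤ K * r := by positivity
    nlinarith
  have hA : 0 ≤ d * r * L := by positivity
  have hB : 0 ≤ n * ε * q := by positivity
  have h6 : d * r * L ≤ K * (d * r * L) := le_mul_of_one_le_left hA hK
  have h7 : n * ε * q ≤ K * (n * ε * q) := le_mul_of_one_le_left hB hK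
  -- The contributions add up to at most `20 K d r L + 12 n ε q`.
  nlinarith

end Regret

/-! ### From pathwise to expected regret. -/

section ExpectedRegret

variable {d : ℕ}

lemma sum_Icc_one_eq_sum_range (f : ℕ → ℝ) (n : ℕ) :
    ∑ t ∈ Finset.Icc 1 n, f t = ∑ t ∈ Finset.range n, f (t + 1) := by
  induction n with
  | zero => simp
  | succ n ih => rw [Finset.sum_Icc_succ_top (by omega), Finset.sum_range_succ, ih]

lemma sSup_meanReward_sub_nonneg {k : ℕ} {Φ : Matrix (Fin k) (Fin d) ℝ} {θ : Fin d → ℝ}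
    {Δ : (Fin d → ℝ) → ℝ} {b : Fin d → ℝ} (hb : b ∈ rows Φ) :
    0 ≤ sSup (meanReward θ Δ '' rows Φ) - meanReward θ Δ b :=
  sub_nonneg.2 (le_csSup ((Set.finite_range _).image _).bddAbove (Set.mem_image_of_mem _ hb))

lemma sSup_meanReward_sub_le {k : ℕ} {Φ : Matrix (Fin k) (Fin d) ℝ} {θ : Fin d → ℝ}
    {Δ : (Fin d → ℝ) → ℝ} {b : Fin d → ℝ} {c : ℝ} (hb : b ∈ rows Φ)
    (h : ∀ a ∈ rows Φ, meanReward θ Δ a - meanReward θ Δ b ≤ c) :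
    sSup (meanReward θ Δ '' rows Φ) - meanReward θ Δ b ≤ c := by
  rw [sub_le_iff_le_add]
  refine csSup_le ⟨_, Set.mem_image_of_mem _ hb⟩ ?_
  rintro _ ⟨a, ha, rfl⟩
  linarith [h a ha]

variable {Ω : Type*} {mΩ : MeasurableSpace Ω} {P : Measure Ω} {n : ℕ} {ε : ℝ} {θ : Fin d → ℝ}
  {Δ : (Fin d → ℝ) → ℝ} {k : ℕ → ℕ} {Φ : (t : ℕ) → Matrix (Fin (k t)) (Fin d) ℝ}
  {η : ℕ → Ω → ℝ} {X : ℕ → Ω → Fin d → ℝ} {Y : ℕ → Ω → ℝ}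

/-- Pathwise bound on the regret of modified LinUCB, in terms of the rounds in which the
confidence bound fails. -/
lemma sum_regret_le (hd : 1 ≤ d) (hΔ : ∀ a, |Δ a| ≤ ε)
    (hΦ : ∀ t ∈ Finset.Icc 1 n, ∀ a ∈ rows (Φ t), euclNorm a ≤ 1 ∧ |a ⬝ᵥ θ| ≤ 1)
    (hY : ∀ t ∈ Finset.Icc 1 n, ∀ ω, Y t ω = X t ω ⬝ᵥ θ + η t ω + Δ (X t ω))
    (halg : ∀ t < n, ∀ ω, X (t + 1) ω ∈ rows (Φ (t + 1)) ∧
      IsMaxOn (ucbIndex n ε (fun s => X s ω) (fun s => Y s ω) t)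
        (rows (Φ (t + 1))) (X (t + 1) ω)) {ρ : ℝ} (hρ : euclNorm θ - 1 ≤ ρ) (ω : Ω) :
    ∑ t ∈ Finset.Icc 1 n, (sSup (meanReward θ Δ '' rows (Φ t)) - meanReward θ Δ (X t ω)) ≤
      n * (2 * ε) + 2 * (confWidth n d + ε * √n) *
        √(n * (2 * (d * Real.log (1 + (n : ℝ) / d)))) +
      (2 + 2 * ε) * ∑ t ∈ Finset.range n,
        (largeNoise X η (confWidth n d - 1 - ρ) t).indicator 1 ω := by
  have hε : 0 ≤ ε := (abs_nonneg _).trans (hΔ 0)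
  have hβ : 0 ≤ confWidth n d := by unfold confWidth; positivity
  have hX1 : ∀ t ∈ Finset.Icc 1 n, euclNorm (X t ω) ≤ 1 := by
    intro t ht
    obtain ⟨s, rfl⟩ : ∃ r, t = r + 1 := ⟨t - 1, by rw [Finset.mem_Icc] at ht; omega⟩
    exact (hΦ _ ht _ (halg s (by rw [Finset.mem_Icc] at ht; omega) ω).1).1
  have hround : ∀ t ∈ Finset.range n,
      sSup (meanReward θ Δ '' rows (Φ (t + 1))) - meanReward θ Δ (X (t + 1) ω) ≤
      2 * ε + 2 * (confWidth n d + ε * √n) * weightedNorm (gram (fun s => X s ω) t)⁻¹ (X (t + 1) ω)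
        + (2 + 2 * ε) * (largeNoise X η (confWidth n d - 1 - ρ) t).indicator 1 ω := by
    intro t ht
    rw [Finset.mem_range] at ht
    have hw := weightedNorm_nonneg (gram (fun s => X s ω) t)⁻¹ (X (t + 1) ω)
    have hmem : t + 1 ∈ Finset.Icc 1 n := by rw [Finset.mem_Icc]; omega
    obtain ⟨hXmem, hmax⟩ := halg t ht ω
    refine sSup_meanReward_sub_le hXmem fun a ha => ?_
    by_cases hbad : ω ∈ largeNoise X η (confWidth n d - 1 - ρ) t
    -- A failing round costs at most `2 + 2ε`, as all mean rewards lie in `[-1 - ε, 1 + ε]`.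
    · rw [Set.indicator_of_mem hbad, Pi.one_apply, mul_one]
      have h1 := (abs_le.1 (hΦ _ hmem a ha).2).2
      have h2 := (abs_le.1 (hΦ _ hmem _ hXmem).2).1
      have h3 := (abs_le.1 (hΔ a)).2
      have h4 := (abs_le.1 (hΔ (X (t + 1) ω))).1
      have h5 : 0 ≤ 2 * (confWidth n d + ε * √n) *
        weightedNorm (gram (fun s => X s ω) t)⁻¹ (X (t + 1) ω) := by positivity
      unfold meanReward
      linarith
    · rw [Set.indicator_of_notMem hbad, mul_zero, add_zero]
      simp only [largeNoise, Set.mem_ofPred_eq, not_lt] at hbad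
      refine (meanReward_sub_le hΔ (fun s hs => hY s ?_ ω) (by linarith) (hmax ha)).trans ?_
      · rw [Finset.mem_Icc] at hs ⊢
        omega
      · gcongr
  rw [sum_Icc_one_eq_sum_range]
  refine (Finset.sum_le_sum hround).trans ?_
  rw [Finset.sum_add_distrib, Finset.sum_add_distrib, Finset.sum_const, Finset.card_range,
    nsmul_eq_mul, ← Finset.mul_sum, ← Finset.mul_sum]
  have hsum := sum_weightedNorm_le (fun s => X s ω) hd hX1
  gcongr

/-- Regret bound for modified LinUCB with explicit constant. -/
theorem regret_le [IsProbabilityMeasure P] (hd : 1 ≤ d) (hn : 2 ≤ n) (hΔ : ∀ a, |Δ a| ≤ ε)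
    (hΦ : ∀ t ∈ Finset.Icc 1 n, ∀ a ∈ rows (Φ t), euclNorm a ≤ 1 ∧ |a ⬝ᵥ θ| ≤ 1)
    {ℱ : Filtration ℕ mΩ} (hη : ∀ t ∈ Finset.Icc 1 n, Measurable[ℱ t] (η t))
    (hind : ∀ t < n, Indep (MeasurableSpace.comap (η (t + 1)) inferInstance) (ℱ t) P)
    (hsub : ∀ t ∈ Finset.Icc 1 n, HasSubgaussianMGF (η t) 1 P)
    (hX : ∀ t < n, Measurable[ℱ t] (X (t + 1)))
    (hY : ∀ t ∈ Finset.Icc 1 n, ∀ ω, Y t ω = X t ω ⬝ᵥ θ + η t ω + Δ (X t ω))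
    (halg : ∀ t < n, ∀ ω, X (t + 1) ω ∈ rows (Φ (t + 1)) ∧
      IsMaxOn (ucbIndex n ε (fun s => X s ω) (fun s => Y s ω) t)
        (rows (Φ (t + 1))) (X (t + 1) ω)) {ρ : ℝ} (hρ0 : 0 ≤ ρ) (hρ : euclNorm θ - 1 ≤ ρ) :
    regret P n Φ θ Δ X ≤ 24 * Real.exp ((1 + d) * ρ ^ 2) *
      (d * √n * Real.log n + n * ε * √(d * Real.log n)) := by
  have hε : 0 ≤ ε := (abs_nonneg _).trans (hΔ 0)
  have hn0 : (0 : ℝ) < n := by exact_mod_cast (by omega : 0 < n)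
  have hrow : ∀ t ∈ Finset.Icc 1 n, ∀ ω, X t ω ∈ rows (Φ t) := by
    intro t ht ω
    rw [Finset.mem_Icc] at ht
    obtain ⟨s, rfl⟩ : ∃ r, t = r + 1 := ⟨t - 1, by omega⟩
    exact (halg s (by omega) ω).1
  have hprob (t : ℕ) (ht : t ∈ Finset.range n) :=
    measure_largeNoise_le hd (by omega) hη hind hsub hX
      (fun t ht ω => (hΦ t ht _ (hrow t ht ω)).1) hρ0 (Finset.mem_range.1 ht).le
  set E := largeNoise X η (confWidth n d - 1 - ρ)
  have hint : ∀ t ∈ Finset.range n, Integrable ((E t).indicator (1 : Ω → ℝ)) P := fun t ht =>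
    (integrable_const (1 : ℝ)).indicator (hprob t ht).1
  set B := n * (2 * ε) + 2 * (confWidth n d + ε * √n) *
        √(n * (2 * (d * Real.log (1 + (n : ℝ) / d)))) with hB
  calc regret P n Φ θ Δ X
      ≤ ∫ ω, B + (2 + 2 * ε) * ∑ t ∈ Finset.range n, (E t).indicator 1 ω ∂P := by
        -- Nonnegativity of the regret and integrability of the upper bound suffice, so `Δ` need not
        -- be measurable.
        refine integral_mono_of_nonneg (ae_of_all _ fun ω => ?_)
          ((integrable_const B).add ((integrable_finsetSum _ hint).const_mul _))
          (ae_of_all _ fun ω => sum_regret_le hd hΔ hΦ hY halg hρ ω)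
        exact Finset.sum_nonneg fun t ht => sSup_meanReward_sub_nonneg (hrow t ht ω)
    _ = B + (2 + 2 * ε) * ∑ t ∈ Finset.range n, P.real (E t) := by
        rw [integral_add (integrable_const B) ((integrable_finsetSum _ hint).const_mul _),
          integral_const_mul, integral_finsetSum _ hint]
        simp only [integral_const, probReal_univ, one_smul]
        congr 2
        exact Finset.sum_congr rfl fun t ht => integral_indicator_one (hprob t ht).1
    _ ≤ _ := by
        refine regret_bound_numeric hd hn hε ?_ ?_
        · calc _ ≤ ∑ t ∈ Finset.range n, (1 : ℝ) := Finset.sum_le_sum fun t _ => measureReal_le_one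
            _ = n := by simp
        · calc _ ≤ ∑ t ∈ Finset.range n, Real.exp (ρ * (confWidth n d - 1)) / n :=
                Finset.sum_le_sum fun t ht => (hprob t ht).2
            _ = _ := by
                rw [Finset.sum_const, Finset.card_range, nsmul_eq_mul]
                field_simp

end ExpectedRegret

end MisspecifiedBandit

theorem mainTheorem10 :
    -- the constant depends at most on `d` and `‖θ‖₂`, and is universal as long as `‖θ‖₂ ≤ 1`
    ∃ C : ℕ → ℝ → ℝ, (∃ C₀ : ℝ, ∀ (d : ℕ) (r : ℝ), r ≤ 1 → C d r = C₀) ∧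
    ∀ (d n : ℕ), 1 ≤ d → 2 ≤ n →
    -- the environment: feature matrices, parameter, misspecification
    ∀ (k : ℕ → ℕ) (Φ : (t : ℕ) → Matrix (Fin (k t)) (Fin d) ℝ) (θ : Fin d → ℝ)
      (ε : ℝ) (Δ : (Fin d → ℝ) → ℝ),
    (∀ a, |Δ a| ≤ ε) →
    (∀ t ∈ Finset.Icc 1 n, ∀ a ∈ MisspecifiedBandit.rows (Φ t),
      MisspecifiedBandit.euclNorm a ≤ 1 ∧ |a ⬝ᵥ θ| ≤ 1) →
    -- the noise `η`, the actions `X`, the rewards `Y`, and the history `ℱ`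
    ∀ (Ω : Type*) (mΩ : MeasurableSpace Ω) (P : Measure Ω) (_ : IsProbabilityMeasure P)
      (ℱ : Filtration ℕ mΩ) (η : ℕ → Ω → ℝ) (X : ℕ → Ω → Fin d → ℝ) (Y : ℕ → Ω → ℝ),
    (∀ t ∈ Finset.Icc 1 n, Measurable[ℱ t] (η t)) →
    (∀ t < n, Indep (MeasurableSpace.comap (η (t + 1)) inferInstance) (ℱ t) P) →
    (∀ t ∈ Finset.Icc 1 n, HasSubgaussianMGF (η t) 1 P) →
    (∀ t < n, Measurable[ℱ t] (X (t + 1))) →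
    (∀ t ∈ Finset.Icc 1 n, ∀ ω, Y t ω = X t ω ⬝ᵥ θ + η t ω + Δ (X t ω)) →
    -- in every round `X` plays an available action of maximal index
    (∀ t < n, ∀ ω, X (t + 1) ω ∈ MisspecifiedBandit.rows (Φ (t + 1)) ∧
      IsMaxOn (MisspecifiedBandit.ucbIndex n ε (fun s => X s ω) (fun s => Y s ω) t)
        (MisspecifiedBandit.rows (Φ (t + 1))) (X (t + 1) ω)) →
    MisspecifiedBandit.regret P n Φ θ Δ X ≤
      C d (MisspecifiedBandit.euclNorm θ) *
        (d * √n * Real.log n + n * ε * √(d * Real.log n)) := by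
  -- The choice `ρ = max (‖θ‖ - 1) 0` vanishes for `‖θ‖ ≤ 1`, leaving the constant `24`.
  refine ⟨fun d r => 24 * Real.exp ((1 + d) * max (r - 1) 0 ^ 2), ⟨24, fun d r hr => ?_⟩, ?_⟩
  · have h : max (r - 1) 0 = 0 := max_eq_right (by linarith)
    simp [h]
  · intro d n hd hn k Φ θ ε Δ hΔ hΦ Ω mΩ P hP ℱ η X Y hη hind hsub hX hY halg
    exact MisspecifiedBandit.regret_le hd hn hΔ hΦ hη hind hsub hX hY halg
      (le_max_right _ _) (le_max_left _ _)
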